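/- Let $G\subset\mathbb{F}_2^{24}$ be the extended binary Golay $[24,12,8]$ code, i.e. (up to a permutation of the 24 coordinates) the extension by a parity bit of the cyclic code of length $23$ generated by $1+x^2+x^4+x^5+x^6+x^{10}+x^{11}$. For a nonempty set $C$ of vertices of a graph $\Gamma$, put $C^{(i)}=\{x: d(x,C)=i\}$. We call $C$ a $\{b_0,\dots,b_{\rho-1};c_1,\dots,c_\rho\}$-CR code if $C^{(0)},\dots,C^{(\rho)}$ are nonempty and partition the vertex set, if this partition is equitable (the number of neighbours in $C^{(j)}$ of a vertex of $C^{(i)}$ depends only on $i$ and $j$; call it $S_{i,j}$), and if $S_{i,i+1}=b_i$ and $S_{i+1,i}=c_{i+1}$ for $0\le i<\rho$. The Hamming graph $H(24,2)$ has vertex set $\mathbb{F}_2^{24}$, two words being adjacent if they differ in exactly one position. The coset graph of $G$ has the cosets of $G$ as vertices, two different cosets being adjacent if some word of one differs from some word of the other in exactly one position. Then no $\{24,21,10;1,4,12\}$-CR code in $H(24,2)$ is a union of cosets of $G$; equivalently, there is no $\{24,21,10;1,4,12\}$-CR code in the coset graph of $G$. -/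

import Mathlib

/-! ### Completely regular codes in graphs -/

/-- The cells `P 0, …, P (k-1)` form an equitable partition of the vertex set of `Γ`, with quotient
matrix `S`: they are nonempty, pairwise disjoint, cover all vertices, and every vertex of `P i` has
exactly `S i j` neighbours in `P j`. -/
structure IsEquitablePartition {V : Type*} (Γ : SimpleGraph V) {k : ℕ} (P : Fin k → Set V)
    (S : Matrix (Fin k) (Fin k) ℕ) : Prop where
  nonempty : ∀ i, (P i).Nonempty
  disjoint : ∀ i j, i ≠ j → Disjoint (P i) (P j)
  cover : ⋃ i, P i = Set.univ
  card_neighbors : ∀ i j, ∀ x ∈ P i, (Γ.neighborSet x ∩ P j).encard = (S i j : ℕ∞)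

/-- The graph distance from the vertex `x` to the set `C`, with value `⊤` if no vertex of `C` can be
reached from `x`. -/
noncomputable def distToSet {V : Type*} (Γ : SimpleGraph V) (x : V) (C : Set V) : ℕ∞ :=
  ⨅ y ∈ C, Γ.edist x y

/-- The cell `C⁽ⁱ⁾` of the distance partition with respect to `C`. -/
def distanceCell {V : Type*} (Γ : SimpleGraph V) (C : Set V) (i : ℕ) : Set V :=
  {x | distToSet Γ x C = (i : ℕ∞)}

/-- `C` is a completely regular code in `Γ` with covering radius `ρ` and intersection array
`{b 0, …, b (ρ-1); c 0, …, c (ρ-1)}` (the `c` are usually numbered from `1`): the distance partition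
`(C⁽⁰⁾, …, C⁽ᵖ⁾)`, `p = ρ`, is equitable, and its quotient matrix `S` satisfies `S i (i+1) = b i`
and `S (i+1) i = c i`. -/
def IsCRCode {V : Type*} (Γ : SimpleGraph V) (C : Set V) {ρ : ℕ} (b c : Fin ρ → ℕ) : Prop :=
  C.Nonempty ∧ ∃ S : Matrix (Fin (ρ + 1)) (Fin (ρ + 1)) ℕ,
    IsEquitablePartition Γ (fun i : Fin (ρ + 1) => distanceCell Γ C i) S ∧
    ∀ i : Fin ρ, S i.castSucc i.succ = b i ∧ S i.succ i.castSucc = c i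

/-! ### Binary Hamming graphs, coset graphs and the extended Golay code -/

/-- The binary Hamming graph `H(n,2)`: words that differ in exactly one position are adjacent. -/
def binaryHammingGraph (n : ℕ) : SimpleGraph (Fin n → ZMod 2) where
  Adj x y := hammingDist x y = 1
  symm := ⟨fun x y h => by rw [hammingDist_comm]; exact h⟩
  loopless := ⟨fun x h => by simp at h⟩

/-- The coset graph of a binary linear code `G`: its vertices are the cosets of `G`, and two
different cosets are adjacent if some word of one is at Hamming distance one from some word of the
other. -/
def cosetGraph {n : ℕ} (G : Submodule (ZMod 2) (Fin n → ZMod 2)) :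
    SimpleGraph ((Fin n → ZMod 2) ⧸ G) where
  Adj A B := A ≠ B ∧ ∃ x y : Fin n → ZMod 2,
    Submodule.Quotient.mk x = A ∧ Submodule.Quotient.mk y = B ∧ hammingDist x y = 1
  symm := ⟨fun _ _ h => by
    obtain ⟨hne, x, y, hx, hy, hd⟩ := h
    exact ⟨hne.symm, y, x, hy, hx, by rw [hammingDist_comm]; exact hd⟩⟩
  loopless := ⟨fun _ h => h.1 rfl⟩

/-- `C` is a union of cosets of the linear code `G`. -/
def IsUnionOfCosets {n : ℕ} (G : Submodule (ZMod 2) (Fin n → ZMod 2))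
    (C : Set (Fin n → ZMod 2)) : Prop :=
  ∃ T : Set (Fin n → ZMod 2), C = ⋃ t ∈ T, {x | ∃ g ∈ G, x = t + g}

/-- Row `i` of a generator matrix of the extended binary Golay code: the coefficients of
`X ^ i * (1 + X ^ 2 + X ^ 4 + X ^ 5 + X ^ 6 + X ^ 10 + X ^ 11)` in the positions `0, …, 22`, followed
by the overall parity bit (always `1`) in position `23`. -/
def golayRow (i : Fin 12) : Fin 24 → ZMod 2 := fun j =>
  if j.val = 23 ∨ ∃ e ∈ ({0, 2, 4, 5, 6, 10, 11} : Finset ℕ), j.val = i.val + e then 1 else 0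

/-- The extended binary Golay code: the cyclic `[23,12,7]` Golay code generated by
`1 + X ^ 2 + X ^ 4 + X ^ 5 + X ^ 6 + X ^ 10 + X ^ 11`, extended by a parity bit. -/
def extendedGolayCode : Submodule (ZMod 2) (Fin 24 → ZMod 2) :=
  Submodule.span (ZMod 2) (Set.range golayRow)

/-- `G` is the extended binary Golay `[24,12,8]` code, in some ordering of the coordinates. -/
def IsExtendedGolayCode (G : Submodule (ZMod 2) (Fin 24 → ZMod 2)) : Prop :=
  ∃ σ : Equiv.Perm (Fin 24),
    G = extendedGolayCode.map (LinearEquiv.funCongrLeft (ZMod 2) (ZMod 2) σ).toLinearMap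

/-! ### Words and sets of coordinates -/

section words

open Finset

variable {n : ℕ}

/-- The characteristic word of a set of coordinates. -/
def charWord (s : Finset (Fin n)) : Fin n → ZMod 2 := fun j => if j ∈ s then 1 else 0

theorem word_add_self (x : Fin n → ZMod 2) : x + x = 0 := by
  funext j
  exact CharTwo.add_self_eq_zero (x j)

theorem charWord_symmDiff (s t : Finset (Fin n)) :
    charWord (symmDiff s t) = charWord s + charWord t := by
  funext j
  by_cases hs : j ∈ s <;> by_cases ht : j ∈ t <;>
    simp [charWord, mem_symmDiff, hs, ht, CharTwo.add_self_eq_zero]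

theorem charWord_injective : Function.Injective (charWord (n := n)) := by
  intro s t h
  ext j
  have := congrFun h j
  by_cases hs : j ∈ s <;> by_cases ht : j ∈ t <;> simp_all [charWord]

theorem charWord_empty : charWord (∅ : Finset (Fin n)) = 0 := by
  funext j; simp [charWord]

theorem charWord_singleton (i : Fin n) : charWord {i} = Pi.single i 1 := by
  funext j
  simp [charWord, Pi.single_apply]

theorem charWord_insert {i : Fin n} {s : Finset (Fin n)} (h : i ∉ s) :
    charWord (insert i s) = Pi.single i 1 + charWord s := by
  funext j
  by_cases hj : j = i
  · subst hj; simp [charWord, h]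
  · simp [charWord, hj]

theorem charWord_pair {i j : Fin n} (h : i ≠ j) :
    charWord {i, j} = Pi.single i 1 + Pi.single j 1 := by
  rw [charWord_insert (by simpa using h), charWord_singleton]

theorem charWord_dotProduct (s t : Finset (Fin n)) :
    charWord s ⬝ᵥ charWord t = (#(s ∩ t) : ZMod 2) := by
  simp [dotProduct, charWord, inter_comm]

theorem card_symmDiff_add (s t : Finset (Fin n)) : #(symmDiff s t) + 2 * #(s ∩ t) = #s + #t := by
  have h1 := card_sdiff_add_card_inter s t
  have h2 := card_sdiff_add_card_inter t s
  have h3 : #(symmDiff s t) = #(s \ t) + #(t \ s) := by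
    rw [symmDiff_def, sup_eq_union, card_union_of_disjoint disjoint_sdiff_sdiff]
  rw [inter_comm t s] at h2
  omega

end words

/-! ### Sextets -/

section sextets

open Finset

/-- If every point lies in a set of size four of the coset of `u`, and likewise for `v`, then some
tetrad of `u` and some tetrad of `v` have two points in common. -/
theorem exists_tetrads_two_le_card_inter (G : Submodule (ZMod 2) (Fin 24 → ZMod 2))
    (hmin : ∀ s : Finset (Fin 24), charWord s ∈ G → s.Nonempty → 8 ≤ #s)
    (horth : ∀ s t : Finset (Fin 24), charWord s ∈ G → charWord t ∈ G → Even #(s ∩ t))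
    (u v : Fin 24 → ZMod 2)
    (hu : ∀ m, ∃ T : Finset (Fin 24), m ∈ T ∧ #T = 4 ∧ u + charWord T ∈ G)
    (hv : ∀ m, ∃ T : Finset (Fin 24), m ∈ T ∧ #T = 4 ∧ v + charWord T ∈ G) :
    ∃ S T : Finset (Fin 24), #S = 4 ∧ #T = 4 ∧ u + charWord S ∈ G ∧ v + charWord T ∈ G ∧
      2 ≤ #(S ∩ T) := by
  by_contra! hcon
  have hsum : ∀ (w : Fin 24 → ZMod 2) (S T : Finset (Fin 24)), w + charWord S ∈ G →
      w + charWord T ∈ G → charWord (symmDiff S T) ∈ G := by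
    intro w S T hS hT
    have h := G.add_mem hS hT
    rw [charWord_symmDiff]
    convert h using 1
    rw [add_add_add_comm, word_add_self, zero_add]
  have hdis : ∀ (w : Fin 24 → ZMod 2) (S T : Finset (Fin 24)), #S = 4 → #T = 4 →
      w + charWord S ∈ G → w + charWord T ∈ G → S ≠ T → Disjoint S T := by
    intro w S T h1 h2 hS hT hne
    have h8 := hmin _ (hsum w S T hS hT) (symmDiff_nonempty.2 hne)
    have := card_symmDiff_add S T
    rw [disjoint_iff_inter_eq_empty, ← card_eq_zero]
    omega
  choose A hmA hA4 hAG using hu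
  choose B hmB hB4 hBG using hv
  have hAeq : ∀ i j, i ∈ A j → A i = A j := by
    intro i j hij
    by_contra hne
    exact disjoint_left.1 (hdis u _ _ (hA4 i) (hA4 j) (hAG i) (hAG j) hne) (hmA i) hij
  -- The tetrads of `u` through the four points of `B 0` cover at most 16 of the 24 coordinates.
  obtain ⟨m, hm⟩ : ∃ m, m ∉ (B 0).biUnion A := by
    by_contra! h
    have h1 : #((B 0).biUnion A) ≤ #(B 0) * 4 := card_biUnion_le_card_mul _ _ _ fun i _ => (hA4 i).le
    rw [eq_univ_of_forall h, hB4] at h1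
    simp at h1
  simp only [mem_biUnion, not_exists, not_and] at hm
  have hmB0 : A m ∩ B 0 = ∅ := by
    ext b
    simp only [mem_inter, notMem_empty, iff_false, not_and]
    intro hb hb0
    exact hm b hb0 (by rw [hAeq b m hb]; exact hmA m)
  have hdAA : Disjoint (A 0) (A m) := by
    refine hdis u _ _ (hA4 0) (hA4 m) (hAG 0) (hAG m) fun h => ?_
    exact hm 0 (hmB 0) (h ▸ hmA m)
  -- Two tetrads of a sextet form an octad; this one meets `B 0` only in the point 0.
  have hO : charWord (A 0 ∪ A m) ∈ G := by
    have := hsum u _ _ (hAG 0) (hAG m)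
    rwa [hdAA.symmDiff_eq_sup] at this
  have hcard : ∀ T, #((A 0 ∪ A m) ∩ T) = #(A 0 ∩ T) + #(A m ∩ T) := by
    intro T
    rw [union_inter_distrib_right, card_union_of_disjoint]
    exact hdAA.mono inter_subset_left inter_subset_left
  have hB0 : #((A 0 ∪ A m) ∩ B 0) = 1 := by
    have h1 := hcon _ _ (hA4 0) (hB4 0) (hAG 0) (hBG 0)
    have h2 : 0 < #(A 0 ∩ B 0) := card_pos.2 ⟨0, mem_inter.2 ⟨hmA 0, hmB 0⟩⟩
    rw [hcard, hmB0, card_empty]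
    omega
  -- The octad meets the codeword `B i ∪ B 0` evenly, so it meets `B i` in an odd number of points,
  -- and that number is at most 1 + 1.
  have hone : ∀ i, #((A 0 ∪ A m) ∩ B i) = 1 := by
    intro i
    have h1 := hcon _ _ (hA4 0) (hB4 i) (hAG 0) (hBG i)
    have h2 := hcon _ _ (hA4 m) (hB4 i) (hAG m) (hBG i)
    by_cases hi : B i = B 0
    · rw [hi, hB0]
    have hd := hdis v _ _ (hB4 i) (hB4 0) (hBG i) (hBG 0) hi
    have h3 := horth _ _ hO (hsum v _ _ (hBG i) (hBG 0))
    rw [hd.symmDiff_eq_sup, sup_eq_union, inter_union_distrib_left, card_union_of_disjoint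
      (hd.mono inter_subset_right inter_subset_right), hB0, hcard] at h3
    rw [hcard]
    obtain ⟨k, hk⟩ := h3
    omega
  -- The eight points of the octad lie in eight different, hence disjoint, tetrads of `v`, which
  -- would need 32 coordinates.
  have hbig : #((A 0 ∪ A m).biUnion B) = ∑ _i ∈ A 0 ∪ A m, 4 := by
    rw [card_biUnion]
    · exact sum_congr rfl fun i _ => hB4 i
    · intro i hi j hj hij
      refine hdis v _ _ (hB4 i) (hB4 j) (hBG i) (hBG j) fun h => hij ?_
      refine card_le_one.1 (hone i).le i ?_ j ?_
      · exact mem_inter.2 ⟨hi, hmB i⟩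
      · exact mem_inter.2 ⟨hj, h ▸ hmB j⟩
  have hle := card_le_univ ((A 0 ∪ A m).biUnion B)
  rw [hbig, sum_const, card_union_of_disjoint hdAA, hA4, hA4] at hle
  simp at hle

end sextets

/-! ### The combinatorial core -/

section core

open Finset

/-- Two sextets built from three triples at one word of `C₀` have tetrads sharing two points, which
yields a word outside `C₀` with six neighbours in `C₁`. -/
theorem false_of_golay_invariant_cells (G : Submodule (ZMod 2) (Fin 24 → ZMod 2))
    (hmin : ∀ s : Finset (Fin 24), charWord s ∈ G → s.Nonempty → 8 ≤ #s)
    (horth : ∀ s t : Finset (Fin 24), charWord s ∈ G → charWord t ∈ G → Even #(s ∩ t))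
    (hcov : ∀ s : Finset (Fin 24), Odd #s →
      ∃ t : Finset (Fin 24), Odd #t ∧ #t ≤ 3 ∧ charWord (symmDiff s t) ∈ G)
    (C₀ C₁ : Set (Fin 24 → ZMod 2)) (hne : C₀.Nonempty)
    (hinv : ∀ x ∈ C₀, ∀ g ∈ G, x + g ∈ C₀)
    (h01 : ∀ x ∈ C₀, ∀ i, x + Pi.single i 1 ∈ C₁) (hdisj : ∀ x ∈ C₀, x ∉ C₁)
    (h10 : ∀ w ∈ C₁, ∃! i, w + Pi.single i 1 ∈ C₀)
    (h11 : ∀ w ∈ C₁, ∃ i, w + Pi.single i 1 ∈ C₁)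
    (hle : ∀ w ∉ C₀, ∀ s : Finset (Fin 24), (∀ i ∈ s, w + Pi.single i 1 ∈ C₁) → #s ≤ 4) :
    False := by
  -- Words form a ring of characteristic two; `linear_combination` uses this equation to cancel
  -- repeated summands.
  have h2 : (2 : Fin 24 → ZMod 2) = 0 := by
    exact one_add_one_eq_two.symm.trans (word_add_self 1)
  have hpair : ∀ x ∈ C₀, ∀ i j, i ≠ j → x + Pi.single i 1 + Pi.single j 1 ∉ C₀ := by
    intro x hx i j hij h
    refine hij ((h10 _ (h01 x hx i)).unique ?_ h)
    rwa [add_assoc, word_add_self, add_zero]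
  -- Step from `x` along `i` into `C₁`, then within `C₁`, then back to `C₀`; any repeated direction
  -- would put a word in both cells.
  have htriple : ∀ x ∈ C₀, ∀ i, ∃ t : Finset (Fin 24), i ∈ t ∧ #t = 3 ∧ x + charWord t ∈ C₀ := by
    intro x hx i
    obtain ⟨j, hj⟩ := h11 _ (h01 x hx i)
    obtain ⟨k, hk, -⟩ := h10 _ hj
    have hij : i ≠ j := by
      rintro rfl
      rw [add_assoc, word_add_self, add_zero] at hj
      exact hdisj _ hx hj
    have hjk : j ≠ k := by
      rintro rfl
      rw [add_assoc, word_add_self, add_zero] at hk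
      exact hdisj _ hk (h01 x hx i)
    have hik : i ≠ k := by
      rintro rfl
      rw [add_right_comm, add_assoc x, word_add_self, add_zero] at hk
      exact hdisj _ hk (h01 x hx j)
    refine ⟨{i, j, k}, by simp, card_eq_three.2 ⟨i, j, k, hij, hik, hjk, rfl⟩, ?_⟩
    rwa [charWord_insert (by simp [hij, hik]), charWord_pair hjk, ← add_assoc, ← add_assoc]
  have htetrad : ∀ y ∈ C₀, ∀ s : Finset (Fin 24), y + charWord s ∈ C₀ → Even #s →
      charWord s ∉ G → ∀ m, ∃ T : Finset (Fin 24), m ∈ T ∧ #T = 4 ∧ charWord s + charWord T ∈ G := by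
    intro y hy s hys hs hsG m
    -- The set `{m} ∆ t` represents the coset of `s` and has even size at most 4. Size 0 would put
    -- `s` in `G`, size 2 would give two words of `C₀` at distance two; size 4 forces `m ∉ t`.
    obtain ⟨t, ht, ht3, htG⟩ := hcov (symmDiff s {m}) (by
      have := card_symmDiff_add s {m}
      rw [card_singleton] at this
      rw [Nat.odd_iff]; rw [Nat.even_iff] at hs; omega)
    rw [symmDiff_assoc, charWord_symmDiff] at htG
    have hU := card_symmDiff_add {m} t
    rw [card_singleton] at hU
    rw [Nat.odd_iff] at ht
    have h0 : #(symmDiff {m} t) ≠ 0 := by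
      intro h
      rw [card_eq_zero] at h
      rw [h, charWord_empty, add_zero] at htG
      exact hsG htG
    have h2' : #(symmDiff {m} t) ≠ 2 := by
      intro h
      obtain ⟨a, b, hab, h⟩ := card_eq_two.1 h
      rw [h, charWord_pair hab] at htG
      refine hpair y hy a b hab ?_
      have := hinv _ hys _ htG
      convert this using 1
      linear_combination (-charWord s) * h2
    refine ⟨symmDiff {m} t, ?_, by omega, htG⟩
    have : m ∉ t := by
      intro hmt
      have : ({m} : Finset (Fin 24)) ∩ t = {m} := by simpa using hmt
      rw [this, card_singleton] at hU
      omega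
    simp [mem_symmDiff, this]
  obtain ⟨x, hx⟩ := hne
  have hexists : ∀ s : Finset (Fin 24), #s < 24 → ∃ i, i ∉ s := by
    intro s hs
    by_contra! h
    rw [eq_univ_of_forall h] at hs
    simp at hs
  obtain ⟨t₁, -, ht₁, hy₁⟩ := htriple x hx 0
  obtain ⟨i, hi⟩ := hexists t₁ (by omega)
  obtain ⟨t₂, hi₂, ht₂, hy₂⟩ := htriple x hx i
  obtain ⟨j, hj⟩ := hexists (t₁ ∪ t₂) (by have := card_union_le t₁ t₂; omega)
  obtain ⟨t₃, hj₃, ht₃, hy₃⟩ := htriple x hx j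
  rw [mem_union, not_or] at hj
  have h12 : t₁ ≠ t₂ := by rintro rfl; exact hi hi₂
  have h13 : t₁ ≠ t₃ := by rintro rfl; exact hj.1 hj₃
  have h23 : t₂ ≠ t₃ := by rintro rfl; exact hj.2 hj₃
  have hnot : ∀ s t : Finset (Fin 24), #s = 3 → #t = 3 → s ≠ t → charWord (symmDiff s t) ∉ G := by
    intro s t hs ht hst h
    have := hmin _ h (symmDiff_nonempty.2 hst)
    have := card_symmDiff_add s t
    omega
  have hev : ∀ s t : Finset (Fin 24), #s = 3 → #t = 3 → Even #(symmDiff s t) := by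
    intro s t hs ht
    have := card_symmDiff_add s t
    rw [Nat.even_iff]; omega
  have hshift : ∀ t, x + charWord t₁ + charWord (symmDiff t₁ t) = x + charWord t := by
    intro t
    rw [charWord_symmDiff]
    linear_combination charWord t₁ * h2
  obtain ⟨S, T, hS, hT, hSG, hTG, hST⟩ := exists_tetrads_two_le_card_inter G hmin horth _ _
    (htetrad _ hy₁ (symmDiff t₁ t₂) (by rwa [hshift]) (hev _ _ ht₁ ht₂) (hnot _ _ ht₁ ht₂ h12))
    (htetrad _ hy₁ (symmDiff t₁ t₃) (by rwa [hshift]) (hev _ _ ht₁ ht₃) (hnot _ _ ht₁ ht₃ h13))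
  obtain ⟨p, hp, hp2⟩ := exists_subset_card_eq hST
  have hpS : p ⊆ S := hp.trans inter_subset_left
  have hpT : p ⊆ T := hp.trans inter_subset_right
  obtain ⟨a, b, hab, rfl⟩ := card_eq_two.1 hp2
  obtain ⟨c, d, hcd, hScd⟩ := card_eq_two.1 (show #(S \ {a, b}) = 2 by
    rw [card_sdiff_of_subset hpS]; omega)
  obtain ⟨c', d', hcd', hTcd⟩ := card_eq_two.1 (show #(T \ {a, b}) = 2 by
    rw [card_sdiff_of_subset hpT]; omega)
  have hsplit : ∀ U : Finset (Fin 24), {a, b} ⊆ U →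
      charWord U = charWord {a, b} + charWord (U \ {a, b}) := by
    intro U hU
    rw [← charWord_symmDiff, disjoint_sdiff.symmDiff_eq_sup, sup_eq_union, union_sdiff_of_subset hU]
  rw [charWord_symmDiff, hsplit S hpS, hScd, charWord_pair hcd] at hSG
  rw [charWord_symmDiff, hsplit T hpT, hTcd, charWord_pair hcd'] at hTG
  -- This is the word that will have too many neighbours in `C₁`.
  have hv : x + charWord t₁ + charWord {a, b} ∉ C₀ := by
    rw [charWord_pair hab, ← add_assoc]
    exact hpair _ hy₁ a b hab
  have hvab : ∀ r ∈ ({a, b} : Finset (Fin 24)),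
      x + charWord t₁ + charWord {a, b} + Pi.single r 1 ∈ C₁ := by
    rw [charWord_pair hab]
    intro r hr
    rw [mem_insert, mem_singleton] at hr
    rcases hr with rfl | rfl
    · convert h01 _ hy₁ b using 1
      linear_combination Pi.single r 1 * h2
    · convert h01 _ hy₁ a using 1
      linear_combination Pi.single r 1 * h2
  have hvcd : x + charWord t₁ + charWord {a, b} + Pi.single c 1 + Pi.single d 1 ∈ C₀ := by
    convert hinv _ hy₂ _ hSG using 1
    linear_combination (-charWord t₂) * h2
  have hvcd' : x + charWord t₁ + charWord {a, b} + Pi.single c' 1 + Pi.single d' 1 ∈ C₀ := by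
    convert hinv _ hy₃ _ hTG using 1
    linear_combination (-charWord t₃) * h2
  have hC₁ : ∀ y : Fin 24 → ZMod 2, ∀ r s, y + Pi.single r 1 + Pi.single s 1 ∈ C₀ →
      y + Pi.single r 1 ∈ C₁ := by
    intro y r s h
    convert h01 _ h s using 1
    rw [add_assoc _ (Pi.single s 1), word_add_self, add_zero]
  have hswap : ∀ y : Fin 24 → ZMod 2, ∀ r s, y + Pi.single r 1 + Pi.single s 1 ∈ C₀ →
      y + Pi.single s 1 + Pi.single r 1 ∈ C₀ := by
    intro y r s h
    rwa [add_right_comm]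
  have hdiff : ∀ r s q, x + charWord t₁ + charWord {a, b} + Pi.single r 1 + Pi.single s 1 ∈ C₀ →
      x + charWord t₁ + charWord {a, b} + Pi.single r 1 + Pi.single q 1 ∈ C₀ → s = q :=
    fun r s q h h' => (h10 _ (hC₁ _ _ _ h)).unique h h'
  have hne2 : ¬ (({c, d} : Finset (Fin 24)) = {c', d'}) := by
    intro h
    refine hnot _ _ ht₂ ht₃ h23 ?_
    have h' := congrArg charWord h
    rw [charWord_pair hcd, charWord_pair hcd'] at h'
    rw [h'] at hSG
    convert G.add_mem hSG hTG using 1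
    rw [charWord_symmDiff]
    linear_combination (-(charWord t₁ + charWord {a, b} + Pi.single c' 1 + Pi.single d' 1)) * h2
  -- A common direction leads to a word of `C₁` whose unique neighbour in `C₀` makes the pairs
  -- equal; then `t₂ ∆ t₃` would be a nonzero codeword of weight at most 6.
  have hdcd : Disjoint ({c, d} : Finset (Fin 24)) {c', d'} := by
    rw [disjoint_left]
    intro r hr hr'
    simp only [mem_insert, mem_singleton] at hr hr'
    apply hne2
    rcases hr with rfl | rfl <;> rcases hr' with rfl | rfl
    · rw [hdiff _ _ _ hvcd hvcd']
    · rw [hdiff _ _ _ hvcd (hswap _ _ _ hvcd'), pair_comm]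
    · rw [hdiff _ _ _ (hswap _ _ _ hvcd) hvcd', pair_comm]
    · rw [hdiff _ _ _ (hswap _ _ _ hvcd) (hswap _ _ _ hvcd')]
  have hdab : Disjoint ({a, b} : Finset (Fin 24)) ({c, d} ∪ {c', d'}) := by
    rw [disjoint_union_right, ← hScd, ← hTcd]
    exact ⟨disjoint_sdiff, disjoint_sdiff⟩
  have h6 := hle _ hv ({a, b} ∪ ({c, d} ∪ {c', d'})) (by
    intro r hr
    rw [mem_union, mem_union] at hr
    rcases hr with hr | hr | hr
    · exact hvab r hr
    · rw [mem_insert, mem_singleton] at hr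
      rcases hr with rfl | rfl
      · exact hC₁ _ _ _ hvcd
      · exact hC₁ _ _ _ (hswap _ _ _ hvcd)
    · rw [mem_insert, mem_singleton] at hr
      rcases hr with rfl | rfl
      · exact hC₁ _ _ _ hvcd'
      · exact hC₁ _ _ _ (hswap _ _ _ hvcd'))
  rw [card_union_of_disjoint hdab, card_union_of_disjoint hdcd, card_pair hab, card_pair hcd,
    card_pair hcd'] at h6
  omega

end core

/-! ### The extended binary Golay code -/

section golay

open Finset

/-- The word whose entries are the binary digits of `k`. -/
def bitWord (k : ℕ) : Fin 24 → ZMod 2 := fun j => if k.testBit j then 1 else 0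

/-- The list of all sums of sublists, where numbers are added bitwise modulo two. -/
def xorSpan : List ℕ → List ℕ
  | [] => [0]
  | r :: l => xorSpan l ++ (xorSpan l).map (r ^^^ ·)

/-- The number of ones among the last 24 binary digits. -/
def bitWeight (k : ℕ) : ℕ := ((List.finRange 24).map fun j => (k.testBit j.val).toNat).sum

theorem bitWord_xor (a b : ℕ) : bitWord (a ^^^ b) = bitWord a + bitWord b := by
  funext j
  simp only [bitWord, Nat.testBit_xor, Pi.add_apply]
  cases a.testBit j <;> cases b.testBit j <;> decide

theorem bitWord_zero : bitWord 0 = 0 := by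
  funext j
  simp [bitWord]

theorem hammingNorm_bitWord (k : ℕ) : hammingNorm (bitWord k) = bitWeight k := by
  rw [hammingNorm, Finset.card_filter, bitWeight, ← Fin.sum_univ_def]
  refine Finset.sum_congr rfl fun j _ => ?_
  cases h : k.testBit j <;> simp [bitWord, h]

theorem exists_mem_xorSpan (l : List ℕ) (x : Fin 24 → ZMod 2)
    (hx : x ∈ Submodule.span (ZMod 2) (bitWord '' {r | r ∈ l})) :
    ∃ k ∈ xorSpan l, x = bitWord k := by
  induction l generalizing x with
  | nil =>
    refine ⟨0, by simp [xorSpan], ?_⟩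
    simpa [bitWord_zero] using hx
  | cons r l ih =>
    have hset : {s | s ∈ r :: l} = insert r {s | s ∈ l} := by
      ext s
      simp
    rw [hset, Set.image_insert_eq, Submodule.mem_span_insert] at hx
    obtain ⟨a, z, hz, rfl⟩ := hx
    obtain ⟨k, hk, rfl⟩ := ih z hz
    obtain rfl | rfl : a = 0 ∨ a = 1 := by
      revert a; decide
    · exact ⟨k, by simp [xorSpan, hk], by simp⟩
    · refine ⟨r ^^^ k, ?_, by simp [bitWord_xor]⟩
      simp only [xorSpan, List.mem_append, List.mem_map]
      exact Or.inr ⟨k, hk, rfl⟩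

/-- The rows of the generator matrix, as binary numbers. -/
def golayBits : List ℕ := (List.range 12).map fun i => 3189 <<< i ^^^ 8388608

/-- The number 3189 has binary digits one exactly at 0, 2, 4, 5, 6, 10, 11, and 8388608 = 2 ^ 23 is
the parity bit. -/
theorem golayRow_eq_bitWord (i : Fin 12) : golayRow i = bitWord (3189 <<< i.val ^^^ 8388608) := by
  revert i
  decide +kernel

theorem eight_le_hammingNorm_of_mem_extendedGolayCode {x : Fin 24 → ZMod 2}
    (hx : x ∈ extendedGolayCode) (h0 : x ≠ 0) : 8 ≤ hammingNorm x := by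
  have hsub : Set.range golayRow ⊆ bitWord '' {r | r ∈ golayBits} := by
    rintro _ ⟨i, rfl⟩
    refine ⟨_, ?_, (golayRow_eq_bitWord i).symm⟩
    exact List.mem_map.2 ⟨i, List.mem_range.2 i.isLt, rfl⟩
  obtain ⟨k, hk, rfl⟩ := exists_mem_xorSpan golayBits x (Submodule.span_mono hsub hx)
  -- Exhaustive check of all 4096 codewords, in natural-number arithmetic so that the kernel can
  -- evaluate it.
  have hall : (xorSpan golayBits).all (fun k => k == 0 || Nat.ble 8 (bitWeight k)) = true := by
    decide +kernel
  have := List.all_eq_true.1 hall k hk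
  rw [Bool.or_eq_true, beq_iff_eq, Nat.ble_eq] at this
  rcases this with rfl | h
  · exact absurd bitWord_zero h0
  · rwa [hammingNorm_bitWord]

theorem dotProduct_eq_zero_of_mem_extendedGolayCode {x y : Fin 24 → ZMod 2}
    (hx : x ∈ extendedGolayCode) (hy : y ∈ extendedGolayCode) : x ⬝ᵥ y = 0 := by
  have hrow : ∀ i j, golayRow i ⬝ᵥ golayRow j = 0 := by
    decide +kernel
  induction hx, hy using Submodule.span_induction₂ with
  | mem_mem x y hx hy =>
    obtain ⟨i, rfl⟩ := hx
    obtain ⟨j, rfl⟩ := hy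
    exact hrow i j
  | zero_left y hy => simp
  | zero_right x hx => simp
  | add_left x y z _ _ _ h1 h2 => rw [add_dotProduct, h1, h2, add_zero]
  | add_right x y z _ _ _ h1 h2 => rw [dotProduct_add, h1, h2, add_zero]
  | smul_left r x y _ _ h => rw [smul_dotProduct, h, smul_zero]
  | smul_right r x y _ _ h => rw [dotProduct_smul, h, smul_zero]

/-- The first twelve columns are triangular with ones on the diagonal. -/
theorem golayRow_linearIndependent : LinearIndependent (ZMod 2) golayRow := by
  rw [Fintype.linearIndependent_iff]
  intro c hc
  have hlow : ∀ i j : Fin 12, i < j → golayRow j (Fin.castLE (by norm_num) i) = 0 := by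
    decide +kernel
  have hdiag : ∀ i : Fin 12, golayRow i (Fin.castLE (by norm_num) i) = 1 := by
    decide +kernel
  intro i
  induction i using WellFoundedLT.induction with
  | _ i ih =>
    have h := congrFun hc (Fin.castLE (by norm_num) i)
    rw [Finset.sum_apply, Finset.sum_eq_single i] at h
    · simpa [hdiag] using h
    · intro j _ hj
      rcases lt_or_gt_of_ne hj with hlt | hlt
      · simp [ih j hlt]
      · simp [hlow i j hlt]
    · simp

theorem finrank_extendedGolayCode : Module.finrank (ZMod 2) extendedGolayCode = 12 := by
  rw [extendedGolayCode, finrank_span_eq_card golayRow_linearIndependent, Fintype.card_fin]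

end golay

/-! ### Properties of the Golay code in an arbitrary ordering of the coordinates -/

section golayProperties

open Finset

variable {G : Submodule (ZMod 2) (Fin 24 → ZMod 2)}

theorem IsExtendedGolayCode.even_card_inter (hG : IsExtendedGolayCode G) (s t : Finset (Fin 24))
    (hs : charWord s ∈ G) (ht : charWord t ∈ G) : Even #(s ∩ t) := by
  obtain ⟨σ, rfl⟩ := hG
  obtain ⟨x, hx, hxs⟩ := hs
  obtain ⟨y, hy, hyt⟩ := ht
  have h := charWord_dotProduct s t
  rw [← hxs, ← hyt] at h
  have h' : (x ∘ σ) ⬝ᵥ (y ∘ σ) = (#(s ∩ t) : ZMod 2) := h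
  rw [comp_equiv_dotProduct_comp_equiv, dotProduct_eq_zero_of_mem_extendedGolayCode hx hy] at h'
  rw [even_iff_two_dvd]
  exact (ZMod.natCast_eq_zero_iff _ _).1 h'.symm

theorem IsExtendedGolayCode.eight_le_card (hG : IsExtendedGolayCode G) (s : Finset (Fin 24))
    (hs : charWord s ∈ G) (hne : s.Nonempty) : 8 ≤ #s := by
  obtain ⟨σ, rfl⟩ := hG
  obtain ⟨x, hx, hxs⟩ := hs
  have hxs' : x ∘ σ = charWord s := hxs
  have h0 : x ≠ 0 := by
    rintro rfl
    apply hne.ne_empty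
    apply charWord_injective
    rw [charWord_empty, ← hxs']
    rfl
  refine (eight_le_hammingNorm_of_mem_extendedGolayCode hx h0).trans_eq ?_
  have hs : s = ({j | x (σ j) ≠ 0} : Finset (Fin 24)) := by
    ext j
    have := congrFun hxs' j
    by_cases hj : j ∈ s <;> simp_all [charWord]
  rw [hs, hammingNorm]
  exact (card_equiv σ (by simp)).symm

theorem IsExtendedGolayCode.finrank_eq (hG : IsExtendedGolayCode G) :
    Module.finrank (ZMod 2) G = 12 := by
  obtain ⟨σ, rfl⟩ := hG
  rw [← finrank_extendedGolayCode]
  exact LinearEquiv.finrank_map_eq _ _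

theorem IsExtendedGolayCode.card_quotient (hG : IsExtendedGolayCode G) :
    Nat.card ((Fin 24 → ZMod 2) ⧸ G) = 4096 := by
  have h := G.finrank_quotient_add_finrank
  rw [hG.finrank_eq, Module.finrank_fin_fun] at h
  have h' : Module.finrank (ZMod 2) ((Fin 24 → ZMod 2) ⧸ G) = 12 := by omega
  rw [Module.natCard_eq_pow_finrank (K := ZMod 2), h', Nat.card_zmod]
  norm_num

/-- Every word of odd weight is at distance one or three from the extended Golay code. -/
theorem IsExtendedGolayCode.exists_odd_card_le_three (hG : IsExtendedGolayCode G)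
    (s : Finset (Fin 24)) (hs : Odd #s) :
    ∃ t : Finset (Fin 24), Odd #t ∧ #t ≤ 3 ∧ charWord (symmDiff s t) ∈ G := by
  have hmk : ∀ a b : Finset (Fin 24),
      Submodule.Quotient.mk (p := G) (charWord a) = Submodule.Quotient.mk (charWord b) →
        charWord (symmDiff a b) ∈ G := by
    intro a b h
    rw [Submodule.Quotient.eq] at h
    rw [charWord_symmDiff]
    convert h using 1
    rw [eq_sub_iff_add_eq, add_assoc, word_add_self, add_zero]
  have heven : ∀ a b : Finset (Fin 24), charWord (symmDiff a b) ∈ G → (Even #a ↔ Even #b) := by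
    intro a b h
    have h1 := hG.even_card_inter _ _ h h
    rw [inter_self] at h1
    have := card_symmDiff_add a b
    simp only [Nat.even_iff] at *
    omega
  let X : Finset (Finset (Fin 24)) := powersetCard 1 univ ∪ powersetCard 3 univ
  have hX : ∀ t ∈ X, Odd #t ∧ #t ≤ 3 := by
    intro t ht
    simp only [X, mem_union, mem_powersetCard_univ] at ht
    rcases ht with h | h <;> rw [h] <;> decide
  -- 24 + 2024, which is half the number of cosets.
  have hcardX : #X = 2048 := by
    rw [card_union_of_disjoint, card_powersetCard, card_powersetCard]
    · rfl
    · rw [disjoint_left]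
      intro t h1 h3
      rw [mem_powersetCard_univ] at h1 h3
      omega
  -- Adding the single coordinate 0 turns odd sets into even ones, so that one count over all 4096
  -- cosets suffices: an injective `f` is bijective, and parity then selects `b = false` for odd
  -- `s`.
  let r : Bool → Finset (Fin 24) := fun b => if b then {0} else ∅
  let f : Bool × X → (Fin 24 → ZMod 2) ⧸ G := fun p =>
    Submodule.Quotient.mk (charWord (symmDiff (r p.1) p.2.1))
  have hparity : ∀ b, ∀ t ∈ X, (Even #(symmDiff (r b) t) ↔ b = true) := by
    intro b t ht
    have h1 := card_symmDiff_add (r b) t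
    have h2 := (hX t ht).1
    rw [Nat.odd_iff] at h2
    rw [Nat.even_iff]
    cases b
    · simp only [r, Bool.false_eq_true, if_false, card_empty, iff_false] at h1 ⊢
      omega
    · simp only [r, if_true, card_singleton, iff_true] at h1 ⊢
      omega
  have hinj : Function.Injective f := by
    rintro ⟨b, t, ht⟩ ⟨b', t', ht'⟩ h
    have h := hmk _ _ h
    have hb := heven _ _ h
    dsimp only at h hb
    rw [hparity b t ht, hparity b' t' ht'] at hb
    obtain rfl : b = b' := Bool.eq_iff_iff.2 hb
    rw [symmDiff_symmDiff_symmDiff_comm, symmDiff_self, bot_symmDiff] at h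
    have htt : t = t' := by
      by_contra hne
      have h8 := hG.eight_le_card _ h (symmDiff_nonempty.2 hne)
      have := card_symmDiff_add t t'
      have := (hX t ht).2
      have := (hX t' ht').2
      omega
    subst htt
    rfl
  have hbij : Function.Bijective f := by
    refine hinj.bijective_of_nat_card_le ?_
    rw [hG.card_quotient, Nat.card_prod, Nat.card_eq_fintype_card, Nat.card_eq_fintype_card,
      Fintype.card_coe, hcardX, Fintype.card_bool]
  obtain ⟨⟨b, t, ht⟩, h⟩ := hbij.2 (Submodule.Quotient.mk (charWord s))
  have h := hmk _ _ h.symm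
  have hb := heven _ _ h
  dsimp only at h hb
  rw [hparity b t ht, ← Nat.not_odd_iff_even] at hb
  obtain rfl : b = false := by
    cases b
    · rfl
    · exact absurd hs (hb.2 rfl)
  refine ⟨t, (hX t ht).1, (hX t ht).2, ?_⟩
  rwa [show symmDiff (r false) t = t from bot_symmDiff t] at h

end golayProperties

/-! ### Completely regular codes -/

section completelyRegular

open Finset

theorem distanceCell_zero {V : Type*} (Γ : SimpleGraph V) (C : Set V) : distanceCell Γ C 0 = C := by
  ext x
  simp only [distanceCell, distToSet, Set.mem_ofPred_eq, Nat.cast_zero]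
  constructor
  · intro h
    by_contra hx
    have : (1 : ℕ∞) ≤ ⨅ y ∈ C, Γ.edist x y := by
      refine le_iInf₂ fun y hy => ?_
      rw [Order.one_le_iff_ne_zero, Ne, SimpleGraph.edist_eq_zero_iff]
      rintro rfl
      exact hx hy
    rw [h] at this
    simp at this
  · intro hx
    refine le_antisymm (iInf₂_le_of_le x hx ?_) (zero_le)
    simp

theorem distToSet_le_add_one {V : Type*} (Γ : SimpleGraph V) (C : Set V) {x y : V}
    (h : Γ.Adj x y) : distToSet Γ x C ≤ distToSet Γ y C + 1 := by
  rw [distToSet, distToSet]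
  by_cases hC : C.Nonempty
  · have := hC.to_subtype
    rw [iInf_subtype', iInf_subtype', ENat.iInf_add]
    refine le_iInf fun z => (iInf_le _ z).trans ?_
    refine (SimpleGraph.edist_triangle (v := y)).trans ?_
    rw [add_comm, SimpleGraph.edist_eq_one_iff_adj.2 h]
  · rw [Set.not_nonempty_iff_eq_empty] at hC
    simp [hC]

/-- Both graphs look locally like 24 coordinate flips, so the cells can be pulled back along `π`:
the identity for the Hamming graph, the quotient map for the coset graph. -/
theorem false_of_isCRCode {W : Type*} (Γ : SimpleGraph W)
    {G : Submodule (ZMod 2) (Fin 24 → ZMod 2)} (hG : IsExtendedGolayCode G)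
    (π : (Fin 24 → ZMod 2) → W) (hπ : Function.Surjective π)
    (hinj : ∀ w : Fin 24 → ZMod 2, Function.Injective fun i : Fin 24 => π (w + Pi.single i 1))
    (hnb : ∀ w : Fin 24 → ZMod 2,
      Γ.neighborSet (π w) = Set.range fun i : Fin 24 => π (w + Pi.single i 1))
    (C : Set W) (hinv : ∀ x, π x ∈ C → ∀ g ∈ G, π (x + g) ∈ C)
    (h : IsCRCode Γ C ![24, 21, 10] ![1, 4, 12]) : False := by
  classical
  obtain ⟨⟨c, hc⟩, S, ⟨-, hdisj, hcover, hcard⟩, hS⟩ := h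
  have hcell : ∀ x, ∃ i : Fin 4, x ∈ distanceCell Γ C i := fun x =>
    Set.mem_iUnion.1 (hcover ▸ Set.mem_univ x)
  choose cell hcellmem using hcell
  have hcell_iff : ∀ x i, x ∈ distanceCell Γ C (i : Fin 4) ↔ cell x = i := by
    intro x i
    constructor
    · intro hx
      by_contra hne
      exact Set.disjoint_left.1 (hdisj _ _ hne) (hcellmem x) hx
    · rintro rfl
      exact hcellmem x
  have hC : ∀ x, x ∈ C ↔ cell x = 0 := by
    intro x
    rw [← hcell_iff, Fin.val_zero, distanceCell_zero]
  have hstep : ∀ x y, Γ.Adj x y → (cell x : ℕ) ≤ cell y + 1 := by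
    intro x y hxy
    have hx : distToSet Γ x C = _ := hcellmem x
    have hy : distToSet Γ y C = _ := hcellmem y
    have := distToSet_le_add_one Γ C hxy
    rw [hx, hy] at this
    exact_mod_cast this
  have hN : ∀ w j, #{k : Fin 24 | cell (π (w + Pi.single k 1)) = j} = S (cell (π w)) j := by
    intro w j
    have h := hcard _ j _ (hcellmem (π w))
    have hset : Γ.neighborSet (π w) ∩ distanceCell Γ C j =
        (fun i : Fin 24 => π (w + Pi.single i 1)) ''
          ↑({k : Fin 24 | cell (π (w + Pi.single k 1)) = j} : Finset (Fin 24)) := by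
      rw [hnb]
      ext x
      simp only [Set.mem_inter_iff, Set.mem_range, hcell_iff, Set.mem_image, coe_filter,
        mem_univ, true_and, Set.mem_ofPred_eq]
      constructor
      · rintro ⟨⟨i, rfl⟩, hi⟩
        exact ⟨i, hi, rfl⟩
      · rintro ⟨i, hi, rfl⟩
        exact ⟨⟨i, rfl⟩, hi⟩
    rw [hset, (hinj w).encard_image, Set.encard_coe_eq_coe_finsetCard] at h
    exact_mod_cast h
  have hrow : ∀ w, S (cell (π w)) 0 + S (cell (π w)) 1 + S (cell (π w)) 2 + S (cell (π w)) 3 =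
      24 := by
    intro w
    have h := card_eq_sum_card_fiberwise (s := univ) (t := univ)
      (f := fun k : Fin 24 => cell (π (w + Pi.single k 1))) fun _ _ => mem_coe.2 (mem_univ _)
    simp only [hN, Fin.sum_univ_four, card_univ, Fintype.card_fin] at h
    exact h.symm
  have hadj : ∀ w k, Γ.Adj (π w) (π (w + Pi.single k 1)) := by
    intro w k
    have : π (w + Pi.single k 1) ∈ Γ.neighborSet (π w) := by
      rw [hnb]
      exact ⟨k, rfl⟩
    exact this
  have hfar : ∀ w j, (cell (π w) : ℕ) + 1 < (j : Fin 4) ∨ (j : ℕ) + 1 < cell (π w) →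
      S (cell (π w)) j = 0 := by
    intro w j hj
    rw [← hN, card_eq_zero, filter_eq_empty_iff]
    rintro k - rfl
    have h1 := hstep _ _ (hadj w k)
    have h2 := hstep _ _ (hadj w k).symm
    omega
  have hS01 : S 0 1 = 24 := (hS 0).1
  have hS10 : S 1 0 = 1 := (hS 0).2
  have hS12 : S 1 2 = 21 := (hS 1).1
  have hS21 : S 2 1 = 4 := (hS 1).2
  -- Adjacent vertices differ by at most one in distance to `C`, so `S 1 3 = 0` and the row sum
  -- leaves 24 - 1 - 21.
  have hS11 : ∀ w, cell (π w) = 1 → S 1 1 = 2 := by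
    intro w hw
    have h1 := hrow w
    have h2 := hfar w 3 (by rw [hw]; decide)
    rw [hw] at h1 h2
    omega
  obtain ⟨x, rfl⟩ := hπ c
  refine false_of_golay_invariant_cells G hG.eight_le_card hG.even_card_inter
    hG.exists_odd_card_le_three {w | cell (π w) = 0} {w | cell (π w) = 1} ⟨x, (hC _).1 hc⟩
    (fun x hx g hg => (hC _).1 (hinv x ((hC _).2 hx) g hg)) ?_ ?_ ?_ ?_ ?_
  · intro w hw i
    have h := hN w 1
    rw [show cell (π w) = 0 from hw, hS01] at h
    have h' := (card_eq_iff_eq_univ _).1 (h.trans (Fintype.card_fin 24).symm)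
    have hi := mem_univ i
    rw [← h', mem_filter] at hi
    exact hi.2
  · intro w hw hw'
    rw [Set.mem_ofPred_eq] at hw hw'
    rw [hw] at hw'
    exact absurd hw' (by decide)
  · intro w hw
    have h := hN w 0
    rw [show cell (π w) = 1 from hw, hS10] at h
    obtain ⟨i, hi⟩ := card_eq_one.1 h
    simp only [Finset.ext_iff, mem_filter, mem_univ, true_and, mem_singleton] at hi
    exact ⟨i, (hi i).2 rfl, fun j hj => (hi j).1 hj⟩
  · intro w hw
    have h := hN w 1
    rw [show cell (π w) = 1 from hw, hS11 w hw] at h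
    obtain ⟨i, hi⟩ := card_pos.1 (h ▸ two_pos)
    exact ⟨i, (mem_filter.1 hi).2⟩
  · intro w hw s hs
    have h : #s ≤ S (cell (π w)) 1 := by
      rw [← hN]
      exact card_le_card fun i hi => mem_filter.2 ⟨mem_univ i, hs i hi⟩
    have hw' : cell (π w) = 1 ∨ cell (π w) = 2 ∨ cell (π w) = 3 := by
      have : ∀ i : Fin 4, i ≠ 0 → i = 1 ∨ i = 2 ∨ i = 3 := by decide
      exact this _ hw
    rcases hw' with hw' | hw' | hw'
    · rw [hw', hS11 w hw'] at h
      omega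
    · rw [hw', hS21] at h
      exact h
    · rw [hfar w 1 (by rw [hw']; decide)] at h
      omega

end completelyRegular

/-! ### The Hamming graph and the coset graph -/

section graphs

open Finset

theorem hammingDist_eq_one_iff {n : ℕ} (x y : Fin n → ZMod 2) :
    hammingDist x y = 1 ↔ ∃ i, y = x + Pi.single i 1 := by
  rw [hammingDist, card_eq_one]
  refine exists_congr fun i => ?_
  simp only [Finset.ext_iff, mem_filter, mem_univ, true_and, mem_singleton, funext_iff,
    Pi.add_apply]
  refine forall_congr' fun j => ?_
  by_cases hj : j = i
  · subst hj
    have : x j ≠ y j ↔ y j = x j + 1 := by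
      generalize x j = a
      generalize y j = b
      revert a b
      decide
    simpa using this
  · simp [hj, eq_comm]

theorem pi_single_one_injective (n : ℕ) :
    Function.Injective fun i : Fin n => (Pi.single i 1 : Fin n → ZMod 2) := by
  intro i j h
  simp only [← charWord_singleton] at h
  exact singleton_injective (charWord_injective h)

theorem binaryHammingGraph_neighborSet (n : ℕ) (w : Fin n → ZMod 2) :
    (binaryHammingGraph n).neighborSet w = Set.range fun i : Fin n => w + Pi.single i 1 := by
  ext y
  rw [SimpleGraph.mem_neighborSet, Set.mem_range]
  refine (hammingDist_eq_one_iff w y).trans (exists_congr fun i => eq_comm)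

variable {G : Submodule (ZMod 2) (Fin 24 → ZMod 2)}

/-- A coincidence would be a codeword of weight two. -/
theorem IsExtendedGolayCode.mk_add_single_injective (hG : IsExtendedGolayCode G)
    (w : Fin 24 → ZMod 2) : Function.Injective fun i : Fin 24 =>
      (Submodule.Quotient.mk (w + Pi.single i 1) : (Fin 24 → ZMod 2) ⧸ G) := by
  intro i j h
  by_contra hij
  have h := (Submodule.Quotient.eq G).1 h
  have hmem : charWord {i, j} ∈ G := by
    rw [charWord_pair hij]
    convert h using 1
    rw [eq_sub_iff_add_eq]
    linear_combination (Pi.single j 1 : Fin 24 → ZMod 2) *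
      (one_add_one_eq_two.symm.trans (word_add_self (1 : Fin 24 → ZMod 2)))
  have := hG.eight_le_card _ hmem (by simp)
  rw [card_pair hij] at this
  omega

theorem IsExtendedGolayCode.cosetGraph_neighborSet (hG : IsExtendedGolayCode G)
    (w : Fin 24 → ZMod 2) : (cosetGraph G).neighborSet (Submodule.Quotient.mk w) =
      Set.range fun i : Fin 24 => Submodule.Quotient.mk (w + Pi.single i 1) := by
  ext A
  rw [SimpleGraph.mem_neighborSet, Set.mem_range]
  constructor
  · rintro ⟨-, x, y, hx, rfl, hd⟩
    obtain ⟨i, rfl⟩ := (hammingDist_eq_one_iff x y).1 hd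
    exact ⟨i, by rw [Submodule.Quotient.mk_add, Submodule.Quotient.mk_add, hx]⟩
  · rintro ⟨i, rfl⟩
    -- The two cosets differ because no codeword has weight one.
    refine ⟨fun h => ?_, w, _, rfl, rfl, (hammingDist_eq_one_iff _ _).2 ⟨i, rfl⟩⟩
    have h := (Submodule.Quotient.eq G).1 h.symm
    rw [add_sub_cancel_left, ← charWord_singleton] at h
    have := hG.eight_le_card _ h (by simp)
    simp at this

end graphs

theorem mainTheorem8 (G : Submodule (ZMod 2) (Fin 24 → ZMod 2)) (hG : IsExtendedGolayCode G) :
    (¬ ∃ C : Set (Fin 24 → ZMod 2), IsUnionOfCosets G C ∧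
      IsCRCode (binaryHammingGraph 24) C ![24, 21, 10] ![1, 4, 12]) ∧
    (¬ ∃ D : Set ((Fin 24 → ZMod 2) ⧸ G),
      IsCRCode (cosetGraph G) D ![24, 21, 10] ![1, 4, 12]) := by
  constructor
  · rintro ⟨C, ⟨T, rfl⟩, hC⟩
    refine false_of_isCRCode _ hG id Function.surjective_id
      (fun w => (add_right_injective w).comp (pi_single_one_injective 24))
      (binaryHammingGraph_neighborSet 24) _ ?_ hC
    intro x hx g hg
    simp only [id, Set.mem_iUnion, Set.mem_ofPred_eq] at hx ⊢
    obtain ⟨t, ht, g', hg', rfl⟩ := hx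
    exact ⟨t, ht, g' + g, G.add_mem hg' hg, add_assoc _ _ _⟩
  · rintro ⟨D, hD⟩
    refine false_of_isCRCode _ hG Submodule.Quotient.mk (Submodule.Quotient.mk_surjective G)
      hG.mk_add_single_injective hG.cosetGraph_neighborSet D ?_ hD
    intro x hx g hg
    rwa [Submodule.Quotient.mk_add, (Submodule.Quotient.mk_eq_zero G).2 hg, add_zero]
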